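/- Let $SG(n)$ be the two-dimensional Sierpinski gasket at stage $n$: $SG(0)$ is a triangle, and $SG(n+1)$ is made of three copies of $SG(n)$, arranged in a triangle, any two of which share one outmost (corner) vertex. Let $v(SG(n))$ be the number of its vertices. An ice model configuration on $SG(n)$ is an orientation of its edges such that at every vertex other than the three outmost ones (which have degree 2) two arrows point inward and two point outward. Let $I(n)$ be the number of ice model configurations on $SG(n)$. Let $pc(n)$ be the number of those for which, at the three outmost vertices, the inward edges are the edge on the bottom side at the left vertex, the edge on the right side at the right vertex and the edge on the right side at the top vertex, the other edge at each of these vertices being directed outward; let $pd(n)$ be defined in the same way, with the inward edge at the top vertex being the one on the left side instead. The entropy per site $S_{I,SG}=\lim_{n\to\infty}\frac{\ln I(n)}{v(SG(n))}$ exists, and $$S_{I,SG}=0.515648810655\ldots,$$ that is, $0.515648810655\le S_{I,SG}<0.515648810656$. Moreover, for every integer $m\ge 1$, $$\frac{2}{3^{m+1}}\ln pc(m)+\frac{2}{3^m}\ln 2\ \le\ S_{I,SG}\ \le\ \frac{2}{3^{m+1}}\ln pd(m)+\frac{2}{3^m}\ln 2,$$ and for $m=8$ the upper and the lower bound differ by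 less than $10^{-101}$, so that they determine $S_{I,SG}$ to more than a hundred significant figures. -/

import Mathlib

namespace SierpinskiIce

/-- The two-dimensional Sierpinski gasket `SG(n)` at stage `n`, as a graph on the points of the
triangular lattice; the pair `(x, y)` stands for the point `x • (1, 0) + y • (1/2, √3/2)`.
`SG(0)` is a triangle, and `SG(n+1)` is made of three copies of `SG(n)` (side length `2 ^ n`)
that pairwise share an outmost vertex. Lattice points outside the gasket are isolated. -/
def gasket : ℕ → SimpleGraph (ℕ × ℕ)
  | 0 => SimpleGraph.fromEdgeSet {s((0, 0), (1, 0)), s((1, 0), (0, 1)), s((0, 1), (0, 0))}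
  | n + 1 => gasket n ⊔ (gasket n).map (fun p => (p.1 + 2 ^ n, p.2)) ⊔
      (gasket n).map (fun p => (p.1, p.2 + 2 ^ n))

/-- The vertices of `SG(n)`: the lattice points that lie on at least one edge. -/
def vertices (n : ℕ) : Set (ℕ × ℕ) := (gasket n).support

/-- The three outmost vertices of `SG(n)`: left, right and top. -/
def outmost (n : ℕ) : Set (ℕ × ℕ) := {(0, 0), (2 ^ n, 0), (0, 2 ^ n)}

/-- `D` is an orientation of the graph `G`: each edge of `G` carries exactly one of its two
directions, and `D` has no other arrows. `D.Adj u v` means that the arrow points from `u`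
to `v`. -/
def IsOrientation {V : Type*} (G : SimpleGraph V) (D : Digraph V) : Prop :=
  ∀ u v, (G.Adj u v ↔ (D.Adj u v ∨ D.Adj v u)) ∧ ¬ (D.Adj u v ∧ D.Adj v u)

/-- The ice rule at the vertex `v`: two arrows point inward and two point outward. -/
def IceRule {V : Type*} (D : Digraph V) (v : V) : Prop :=
  {u | D.Adj u v}.ncard = 2 ∧ {u | D.Adj v u}.ncard = 2

/-- The ice model configurations on `SG(n)`: orientations that obey the ice rule at every
vertex other than the three outmost ones. -/
def iceConfigs (n : ℕ) : Set (Digraph (ℕ × ℕ)) :=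
  {D | IsOrientation (gasket n) D ∧ ∀ v ∈ vertices n, v ∉ outmost n → IceRule D v}

/-- `I(n)`, the number of ice model configurations on `SG(n)`. -/
noncomputable def iceCount (n : ℕ) : ℕ := (iceConfigs n).ncard

/-- `pc(n)`, the number of ice model configurations on `SG(n)` in which each outmost vertex has
one edge directed inward and one edge directed outward, where the edges directed inward are: at
the right and at the top vertex those on the upper-right side, at the left vertex the one on the
bottom side. -/
noncomputable def pcCount (n : ℕ) : ℕ :=
  {D ∈ iceConfigs n |
    (D.Adj (1, 0) (0, 0) ∧ D.Adj (0, 0) (0, 1)) ∧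
    (D.Adj (2 ^ n - 1, 1) (2 ^ n, 0) ∧ D.Adj (2 ^ n, 0) (2 ^ n - 1, 0)) ∧
    (D.Adj (1, 2 ^ n - 1) (0, 2 ^ n) ∧ D.Adj (0, 2 ^ n) (0, 2 ^ n - 1))}.ncard

/-- `pd(n)`, the number of ice model configurations on `SG(n)` in which each outmost vertex has
one edge directed inward and one edge directed outward, where the edges directed inward are on
three different sides: at the left vertex on the bottom side, at the right vertex on the
upper-right side, at the top vertex on the upper-left side. -/
noncomputable def pdCount (n : ℕ) : ℕ :=
  {D ∈ iceConfigs n |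
    (D.Adj (1, 0) (0, 0) ∧ D.Adj (0, 0) (0, 1)) ∧
    (D.Adj (2 ^ n - 1, 1) (2 ^ n, 0) ∧ D.Adj (2 ^ n, 0) (2 ^ n - 1, 0)) ∧
    (D.Adj (0, 2 ^ n - 1) (0, 2 ^ n) ∧ D.Adj (0, 2 ^ n) (1, 2 ^ n - 1))}.ncard

/-- The lower bound for the entropy per site computed at stage `m`. -/
noncomputable def lowerBound (m : ℕ) : ℝ :=
  2 / 3 ^ (m + 1) * Real.log (pcCount m) + 2 / 3 ^ m * Real.log 2

/-- The upper bound for the entropy per site computed at stage `m`. -/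
noncomputable def upperBound (m : ℕ) : ℝ :=
  2 / 3 ^ (m + 1) * Real.log (pdCount m) + 2 / 3 ^ m * Real.log 2

end SierpinskiIce

/-! Each copy of SG(n) in SG(n+1) keeps one outmost vertex and shares the other two. A configuration
on SG(n+1) is thus a triple of configurations on SG(n) whose inward counts at each shared vertex add
up to 2 (`glue_mem_iceConfigs`), and the numbers of configurations with prescribed corner states
obey a recursion (`stateCount_succ`). The inward counts at the three corners sum to 3, so either all
corners are neutral (count 1) or the counts are 0, 1, 2 in some order. Only four nonzero values a, b
(charged corners) and c = pc, d = pd (all neutral) occur, see `stateCount_eq`.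

Put s = a + b, t = d + 3c, e = b - a, with primes for the next stage. Then s' = s²(2t + s), t' = 4t³
+ s³, e' = s²e, d' - c' = se², and I = 6s + 2t. Since t' ≥ 4t³, log(2t)/3^n increases; since s ≤ t,
I lies between 2t and 8t. With v ~ 3^(n+1)/2 this gives S = (2/3) lim log(2t)/3^n. The bounds at
stage m are (2/3) log(8c)/3^m and (2/3) log(8d)/3^m, where 8c ≤ 2t ≤ 8d.

The delicate point is that log(8d)/3^n decreases, that is, t³ + a³ + b³ ≤ (4d)³. As t = 4d - 3(d -
c), it suffices that a³ + b³ ≤ 9(d - c)t² (`cube_add_cube_le`), which follows from 3s⁵ ≤ 16t³e² one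
stage earlier (`three_mul_chargedCount_pow_le`). -/

namespace SierpinskiIce

/-! ### Geometry of the gasket and its three copies -/

/-- The outmost vertices of `SG(n)`, which are also the translations that carry `SG(n)` to its
three copies in `SG(n+1)`. -/
def corner (n : ℕ) : Fin 3 → ℕ × ℕ := ![(0, 0), (2 ^ n, 0), (0, 2 ^ n)]

/-- The neighbour of `corner n i` on the side that leads to `corner n j`, for `j ≠ i`. -/
def nbr : ℕ → Fin 3 → Fin 3 → ℕ × ℕ
  | 0, _, j => corner 0 j
  | n + 1, i, j => nbr n i j + corner n i

theorem range_corner (n : ℕ) : Set.range (corner n) = outmost n := by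
  ext v
  simp [outmost, corner]
  tauto

theorem corner_succ (n : ℕ) (i : Fin 3) : corner (n + 1) i = corner n i + corner n i := by
  fin_cases i <;> simp [corner, pow_succ, mul_two]

theorem corner_injective (n : ℕ) : Function.Injective (corner n) := by
  have : 0 < 2 ^ n := by positivity
  intro i j
  fin_cases i <;> fin_cases j <;> simp [corner] <;> omega

theorem gasket_zero_adj (u v : ℕ × ℕ) :
    (gasket 0).Adj u v ↔ ∃ i j, i ≠ j ∧ u = corner 0 i ∧ v = corner 0 j := by
  simp only [gasket, SimpleGraph.fromEdgeSet_adj, Fin.exists_fin_succ, corner]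
  simp
  grind

theorem gasket_succ_adj (n : ℕ) (u v : ℕ × ℕ) :
    (gasket (n + 1)).Adj u v ↔ ∃ i u' v', (gasket n).Adj u' v' ∧
      u' + corner n i = u ∧ v' + corner n i = v := by
  simp only [gasket, SimpleGraph.sup_adj, SimpleGraph.map_adj', Fin.exists_fin_succ, corner]
  have hne : ∀ w : ℕ × ℕ, (∃ u' v', (gasket n).Adj u' v' ∧ u' + w = u ∧ v' + w = v) → u ≠ v := by
    rintro w ⟨u', v', h, rfl, rfl⟩ h'
    exact h.ne (add_right_cancel h')
  have h1 := hne (2 ^ n, 0)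
  have h2 := hne (0, 2 ^ n)
  simp only [Prod.ext_iff, Prod.fst_add, Prod.snd_add] at h1 h2 ⊢
  simp at h1 h2 ⊢
  grind

theorem add_le_of_adj {n : ℕ} {u v : ℕ × ℕ} (h : (gasket n).Adj u v) : u.1 + u.2 ≤ 2 ^ n := by
  induction n generalizing u v with
  | zero =>
    obtain ⟨i, j, -, rfl, -⟩ := (gasket_zero_adj u v).1 h
    fin_cases i <;> simp [corner]
  | succ n ih =>
    obtain ⟨i, u', v', h', rfl, -⟩ := (gasket_succ_adj n u v).1 h
    have := ih h'
    fin_cases i <;> simp [corner, pow_succ] <;> omega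

theorem add_le_of_mem_vertices {n : ℕ} {u : ℕ × ℕ} (h : u ∈ vertices n) : u.1 + u.2 ≤ 2 ^ n := by
  obtain ⟨v, hv⟩ := h
  exact add_le_of_adj hv

/-- Within a copy x + y ≤ 2^n, so copies i and j meet in a single point: corner j of copy i, which
is corner i of copy j. -/
theorem eq_corner_of_add_corner_eq {n : ℕ} {u v : ℕ × ℕ} (hu : u ∈ vertices n)
    (hv : v ∈ vertices n) {i j : Fin 3} (hij : i ≠ j) (h : u + corner n i = v + corner n j) :
    u = corner n j ∧ v = corner n i := by
  have hu := add_le_of_mem_vertices hu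
  have hv := add_le_of_mem_vertices hv
  obtain ⟨u1, u2⟩ := u
  obtain ⟨v1, v2⟩ := v
  fin_cases i <;> fin_cases j <;> simp [corner] at hij h hu hv ⊢ <;> omega

/-- Distinct copies share one vertex only, hence no edge; each edge of SG(n+1) thus belongs to a
unique copy. -/
theorem copy_eq_of_adj {n : ℕ} {u v u' v' : ℕ × ℕ} (h : (gasket n).Adj u v)
    (h' : (gasket n).Adj u' v') {i j : Fin 3} (hu : u + corner n i = u' + corner n j)
    (hv : v + corner n i = v' + corner n j) : i = j := by
  by_contra hij
  have h1 := eq_corner_of_add_corner_eq ⟨_, h⟩ ⟨_, h'⟩ hij hu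
  have h2 := eq_corner_of_add_corner_eq ⟨_, h.symm⟩ ⟨_, h'.symm⟩ hij hv
  exact h.ne (h1.1.trans h2.1.symm)

theorem corner_mem_vertices (n : ℕ) (i : Fin 3) : corner n i ∈ vertices n := by
  induction n with
  | zero => exact ⟨corner 0 (i + 1), (gasket_zero_adj _ _).2 ⟨i, i + 1, by revert i; decide, rfl, rfl⟩⟩
  | succ n ih =>
    obtain ⟨v, hv⟩ := ih
    exact ⟨v + corner n i,
      (gasket_succ_adj n _ _).2 ⟨i, _, v, hv, (corner_succ n i).symm, rfl⟩⟩

theorem adj_corner_iff (n : ℕ) (i : Fin 3) (v : ℕ × ℕ) :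
    (gasket n).Adj (corner n i) v ↔ ∃ j, j ≠ i ∧ v = nbr n i j := by
  induction n generalizing v with
  | zero =>
    rw [gasket_zero_adj]
    constructor
    · rintro ⟨i', j, hij, h, rfl⟩
      obtain rfl := corner_injective 0 h
      exact ⟨j, hij.symm, rfl⟩
    · rintro ⟨j, hij, rfl⟩
      exact ⟨i, j, hij.symm, rfl, rfl⟩
  | succ n ih =>
    rw [gasket_succ_adj]
    constructor
    · rintro ⟨k, u', v', h, hu, rfl⟩
      rw [corner_succ] at hu
      by_cases hki : k = i
      · subst hki
        obtain rfl := add_right_cancel hu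
        obtain ⟨j, hj, rfl⟩ := (ih v').1 h
        exact ⟨j, hj, rfl⟩
      · have := eq_corner_of_add_corner_eq ⟨_, h⟩ (corner_mem_vertices n i) hki hu
        exact absurd (corner_injective n this.2).symm hki
    · rintro ⟨j, hj, rfl⟩
      exact ⟨i, _, _, (ih _).2 ⟨j, hj, rfl⟩, (corner_succ n i).symm, rfl⟩

theorem nbr_injective (n : ℕ) (i : Fin 3) : Function.Injective (nbr n i) := by
  induction n with
  | zero => exact corner_injective 0
  | succ n ih => exact fun j k h => ih (add_right_cancel h)

theorem adj_corner_iff' (n : ℕ) (i : Fin 3) (v : ℕ × ℕ) :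
    (gasket n).Adj (corner n i) v ↔ v = nbr n i (i + 1) ∨ v = nbr n i (i + 2) := by
  rw [adj_corner_iff]
  fin_cases i <;> simp [Fin.exists_fin_succ]
  exact or_comm

theorem corner_adj_nbr_next (n : ℕ) (i : Fin 3) : (gasket n).Adj (corner n i) (nbr n i (i + 1)) :=
  (adj_corner_iff' n i _).2 (Or.inl rfl)

theorem corner_adj_nbr_prev (n : ℕ) (i : Fin 3) : (gasket n).Adj (corner n i) (nbr n i (i + 2)) :=
  (adj_corner_iff' n i _).2 (Or.inr rfl)

theorem nbr_next_ne_prev (n : ℕ) (i : Fin 3) : nbr n i (i + 1) ≠ nbr n i (i + 2) := fun h => by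
  have := nbr_injective n i h
  clear h
  revert i
  decide

theorem nbr_left (n : ℕ) : nbr n 0 1 = (1, 0) ∧ nbr n 0 2 = (0, 1) := by
  induction n with
  | zero => simp [nbr, corner]
  | succ n ih => simp [nbr, ih, corner]

theorem nbr_right (n : ℕ) : nbr n 1 0 = (2 ^ n - 1, 0) ∧ nbr n 1 2 = (2 ^ n - 1, 1) := by
  induction n with
  | zero => simp [nbr, corner]
  | succ n ih =>
    have : 0 < 2 ^ n := by positivity
    simp [nbr, ih, corner, pow_succ]
    omega

theorem nbr_top (n : ℕ) : nbr n 2 0 = (0, 2 ^ n - 1) ∧ nbr n 2 1 = (1, 2 ^ n - 1) := by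
  induction n with
  | zero => simp [nbr, corner]
  | succ n ih =>
    have : 0 < 2 ^ n := by positivity
    simp [nbr, ih, corner, pow_succ]
    omega

theorem mem_vertices_succ (n : ℕ) (v : ℕ × ℕ) :
    v ∈ vertices (n + 1) ↔ ∃ i, ∃ v' ∈ vertices n, v' + corner n i = v := by
  simp only [vertices, SimpleGraph.mem_support, gasket_succ_adj]
  constructor
  · rintro ⟨_, i, u', v', h, rfl, rfl⟩
    exact ⟨i, u', ⟨v', h⟩, rfl⟩
  · rintro ⟨i, v', ⟨u', h⟩, rfl⟩
    exact ⟨_, i, v', u', h, rfl, rfl⟩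

theorem finite_vertices (n : ℕ) : (vertices n).Finite := by
  refine ((Finset.range (2 ^ n + 1) ×ˢ Finset.range (2 ^ n + 1)).finite_toSet).subset ?_
  intro v hv
  have := add_le_of_mem_vertices hv
  simp
  omega

theorem two_mul_ncard_vertices (n : ℕ) : 2 * (vertices n).ncard = 3 ^ (n + 1) + 3 := by
  induction n with
  | zero =>
    have : vertices 0 = Set.range (corner 0) := by
      ext v
      simp only [vertices, SimpleGraph.mem_support, gasket_zero_adj, Set.mem_range]
      constructor
      · rintro ⟨_, i, j, -, rfl, -⟩
        exact ⟨i, rfl⟩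
      · rintro ⟨i, rfl⟩
        exact ⟨_, i, i + 1, by revert i; decide, rfl, rfl⟩
    rw [this, Set.ncard_range_of_injective (corner_injective 0)]
    simp
  | succ n ih =>
    set A : Fin 3 → Set (ℕ × ℕ) := fun i => (· + corner n i) '' vertices n with hA
    have hc : ∀ i, (A i).ncard = (vertices n).ncard := fun i =>
      Set.ncard_image_of_injective _ (add_left_injective _)
    have hf : ∀ i, (A i).Finite := fun i => (finite_vertices n).image _
    have hU : vertices (n + 1) = A 0 ∪ A 1 ∪ A 2 := by
      ext v
      simp [mem_vertices_succ, hA, Fin.exists_fin_succ, or_assoc]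
    have hI : ∀ i j, i ≠ j → A i ∩ A j = {corner n i + corner n j} := by
      intro i j hij
      ext v
      constructor
      · rintro ⟨⟨u, hu, rfl⟩, ⟨u', hu', h⟩⟩
        have := eq_corner_of_add_corner_eq hu hu' hij h.symm
        simp [this.1, add_comm]
      · rintro rfl
        exact ⟨⟨_, corner_mem_vertices n j, add_comm _ _⟩, ⟨_, corner_mem_vertices n i, rfl⟩⟩
    have h01 := Set.ncard_union_add_ncard_inter (A 0) (A 1) (hf 0) (hf 1)
    have h2 := Set.ncard_union_add_ncard_inter (A 0 ∪ A 1) (A 2) ((hf 0).union (hf 1)) (hf 2)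
    -- The third copy meets the union of the first two in exactly two points, as needed for
    -- inclusion-exclusion.
    have hne : corner n 0 + corner n 2 ≠ corner n 1 + corner n 2 := fun h =>
      absurd (corner_injective n (add_right_cancel h)) (by decide)
    rw [hI 0 1 (by decide), Set.ncard_singleton] at h01
    rw [Set.union_inter_distrib_right, hI 0 2 (by decide), hI 1 2 (by decide),
      Set.singleton_union, Set.ncard_pair hne, ← hU] at h2
    simp only [hc] at h01 h2
    rw [pow_succ]
    omega

/-! ### Cutting and gluing orientations -/

theorem IsOrientation.adj {V : Type*} {G : SimpleGraph V} {D : Digraph V} (h : IsOrientation G D)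
    {u v : V} (huv : D.Adj u v) : G.Adj u v :=
  (h u v).1.2 (Or.inl huv)

theorem IsOrientation.not_adj_iff {V : Type*} {G : SimpleGraph V} {D : Digraph V}
    (h : IsOrientation G D) {u v : V} (huv : G.Adj u v) : ¬ D.Adj u v ↔ D.Adj v u := by
  have := h u v
  tauto

/-- The digraph with all arrows reversed. -/
def reverse {V : Type*} (D : Digraph V) : Digraph V := ⟨fun u v => D.Adj v u⟩

theorem IsOrientation.reverse {V : Type*} {G : SimpleGraph V} {D : Digraph V}
    (h : IsOrientation G D) : IsOrientation G (reverse D) := fun u v => by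
  have := h u v
  simp only [SierpinskiIce.reverse]
  tauto

/-- The union of three digraphs, placed on the three copies of `SG(n)` in `SG(n+1)`. -/
def glue (n : ℕ) (E : Fin 3 → Digraph (ℕ × ℕ)) : Digraph (ℕ × ℕ) :=
  ⟨fun u v => ∃ i u' v', (E i).Adj u' v' ∧ u' + corner n i = u ∧ v' + corner n i = v⟩

/-- The part of a digraph that lies on one copy of `SG(n)` in `SG(n+1)`. -/
def piece (n : ℕ) (D : Digraph (ℕ × ℕ)) (i : Fin 3) : Digraph (ℕ × ℕ) :=
  ⟨fun u v => (gasket n).Adj u v ∧ D.Adj (u + corner n i) (v + corner n i)⟩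

/-- Outward arrows are the inward arrows of the reversed digraph, so the outward half of the ice
rule reduces to statements about inward arrows. -/
theorem reverse_glue (n : ℕ) (E : Fin 3 → Digraph (ℕ × ℕ)) :
    reverse (glue n E) = glue n fun i => reverse (E i) := by
  ext u v
  simp only [reverse, glue]
  grind

section Glue

variable {n : ℕ} {E : Fin 3 → Digraph (ℕ × ℕ)} (hE : ∀ i, IsOrientation (gasket n) (E i))
include hE

theorem glue_adj_add {i : Fin 3} {u v : ℕ × ℕ} (h : (gasket n).Adj u v) :
    (glue n E).Adj (u + corner n i) (v + corner n i) ↔ (E i).Adj u v := by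
  constructor
  · rintro ⟨j, u', v', h', hu, hv⟩
    obtain rfl := copy_eq_of_adj ((hE j).adj h') h hu hv
    rwa [add_right_cancel hu, add_right_cancel hv] at h'
  · exact fun h' => ⟨i, u, v, h', rfl, rfl⟩

theorem isOrientation_glue : IsOrientation (gasket (n + 1)) (glue n E) := by
  refine fun u v => ⟨?_, ?_⟩
  · rw [gasket_succ_adj]
    constructor
    · rintro ⟨i, u', v', h, rfl, rfl⟩
      rw [glue_adj_add hE h, glue_adj_add hE h.symm]
      exact (hE i u' v').1.1 h
    · rintro (⟨i, u', v', h, rfl, rfl⟩ | ⟨i, u', v', h, rfl, rfl⟩)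
      · exact ⟨i, _, _, (hE i).adj h, rfl, rfl⟩
      · exact ⟨i, _, _, ((hE i).adj h).symm, rfl, rfl⟩
  · rintro ⟨⟨i, u', v', h, rfl, rfl⟩, h'⟩
    rw [glue_adj_add hE ((hE i).adj h).symm] at h'
    exact (hE i u' v').2 ⟨h, h'⟩

theorem piece_glue : piece n (glue n E) = E := by
  ext i u v
  constructor
  · rintro ⟨h, h'⟩
    exact (glue_adj_add hE h).1 h'
  · exact fun h => ⟨(hE i).adj h, i, u, v, h, rfl, rfl⟩

theorem setOf_glue_adj_interior {i : Fin 3} {v : ℕ × ℕ} (hv : v ∈ vertices n)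
    (hv' : v ∉ outmost n) :
    {u | (glue n E).Adj u (v + corner n i)} = (· + corner n i) '' {u | (E i).Adj u v} := by
  ext u
  constructor
  · rintro ⟨j, u', v', h, rfl, h'⟩
    by_cases hij : i = j
    · subst hij
      obtain rfl := add_right_cancel h'
      exact ⟨u', h, rfl⟩
    · have := eq_corner_of_add_corner_eq hv ⟨_, ((hE j).adj h).symm⟩ hij h'.symm
      rw [← range_corner] at hv'
      exact absurd ⟨j, this.1.symm⟩ hv'
  · rintro ⟨u', h, rfl⟩
    exact ⟨i, u', v, h, rfl, rfl⟩

theorem ncard_glue_adj_interior {i : Fin 3} {v : ℕ × ℕ} (hv : v ∈ vertices n)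
    (hv' : v ∉ outmost n) :
    {u | (glue n E).Adj u (v + corner n i)}.ncard = {u | (E i).Adj u v}.ncard := by
  rw [setOf_glue_adj_interior hE hv hv', Set.ncard_image_of_injective _ (add_left_injective _)]

theorem iceRule_glue_interior {i : Fin 3} {v : ℕ × ℕ} (hv : v ∈ vertices n)
    (hv' : v ∉ outmost n) : IceRule (glue n E) (v + corner n i) ↔ IceRule (E i) v := by
  have h := ncard_glue_adj_interior (fun i => (hE i).reverse) (i := i) hv hv'
  rw [← reverse_glue] at h
  simp only [IceRule, ncard_glue_adj_interior hE hv hv']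
  simp only [reverse] at h
  rw [h]

theorem setOf_glue_adj_middle {i j : Fin 3} (hij : i ≠ j) :
    {u | (glue n E).Adj u (corner n i + corner n j)} =
      (· + corner n i) '' {u | (E i).Adj u (corner n j)} ∪
      (· + corner n j) '' {u | (E j).Adj u (corner n i)} := by
  ext u
  constructor
  · rintro ⟨k, u', v', h, rfl, h'⟩
    have hv := ((hE k).adj h).symm
    by_cases hki : k = i
    · subst hki
      rw [add_comm] at h'
      obtain rfl := add_left_cancel h'
      exact Or.inl ⟨u', h, rfl⟩
    · have h1 := eq_corner_of_add_corner_eq ⟨_, hv⟩ (corner_mem_vertices n j) hki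
        (h'.trans (add_comm _ _))
      obtain rfl := corner_injective n h1.2
      obtain rfl := h1.1
      exact Or.inr ⟨u', h, rfl⟩
  · rintro (⟨u', h, rfl⟩ | ⟨u', h, rfl⟩)
    · exact ⟨i, _, _, h, rfl, add_comm _ _⟩
    · exact ⟨j, _, _, h, rfl, rfl⟩

end Glue

theorem isOrientation_piece {n : ℕ} {D : Digraph (ℕ × ℕ)}
    (hD : IsOrientation (gasket (n + 1)) D) (i : Fin 3) : IsOrientation (gasket n) (piece n D i) := by
  intro u v
  have h1 := hD (u + corner n i) (v + corner n i)
  have h2 : (gasket n).Adj u v → (gasket (n + 1)).Adj (u + corner n i) (v + corner n i) :=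
    fun h => (gasket_succ_adj n _ _).2 ⟨i, u, v, h, rfl, rfl⟩
  have h3 := (gasket n).adj_comm u v
  simp only [piece]
  tauto

theorem glue_piece {n : ℕ} {D : Digraph (ℕ × ℕ)} (hD : IsOrientation (gasket (n + 1)) D) :
    glue n (piece n D) = D := by
  ext u v
  constructor
  · rintro ⟨i, u', v', h, rfl, rfl⟩
    exact h.2
  · intro h
    obtain ⟨i, u', v', h', rfl, rfl⟩ := (gasket_succ_adj n u v).1 (hD.adj h)
    exact ⟨i, u', v', ⟨h', h⟩, rfl, rfl⟩

/-! ### Corner states and the ice rule at shared vertices -/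

open Classical in
/-- The state of an orientation at the outmost vertex `corner n i`: whether the arrow on the side
towards the next, respectively the previous, outmost vertex points inward. -/
noncomputable def state (n : ℕ) (D : Digraph (ℕ × ℕ)) (i : Fin 3) : Bool × Bool :=
  (decide (D.Adj (nbr n i (i + 1)) (corner n i)), decide (D.Adj (nbr n i (i + 2)) (corner n i)))

/-- The number of inward arrows in a corner state. -/
def inCount : Bool × Bool → Fin 3
  | (true, true) => 2
  | (false, false) => 0
  | _ => 1

theorem state_glue {n : ℕ} {E : Fin 3 → Digraph (ℕ × ℕ)}
    (hE : ∀ i, IsOrientation (gasket n) (E i)) (i : Fin 3) :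
    state (n + 1) (glue n E) i = state n (E i) i := by
  refine Prod.ext (decide_eq_decide.2 ?_) (decide_eq_decide.2 ?_) <;> rw [corner_succ]
  · exact glue_adj_add hE (corner_adj_nbr_next n i).symm
  · exact glue_adj_add hE (corner_adj_nbr_prev n i).symm

theorem ncard_adj_corner {n : ℕ} {D : Digraph (ℕ × ℕ)} (hD : IsOrientation (gasket n) D)
    (i : Fin 3) : {u | D.Adj u (corner n i)}.ncard = inCount (state n D i) := by
  have hne := nbr_next_ne_prev n i
  have hsub : ∀ u, D.Adj u (corner n i) → u = nbr n i (i + 1) ∨ u = nbr n i (i + 2) :=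
    fun u h => (adj_corner_iff' n i u).1 (hD.adj h).symm
  simp only [state]
  by_cases h1 : D.Adj (nbr n i (i + 1)) (corner n i) <;>
    by_cases h2 : D.Adj (nbr n i (i + 2)) (corner n i) <;>
    simp only [h1, h2, decide_true, decide_false, inCount]
  · rw [show {u | D.Adj u (corner n i)} = {nbr n i (i + 1), nbr n i (i + 2)} by
      ext u; simp only [Set.mem_ofPred_eq, Set.mem_insert_iff, Set.mem_singleton_iff]; grind]
    exact Set.ncard_pair hne
  · rw [show {u | D.Adj u (corner n i)} = {nbr n i (i + 1)} by
      ext u; simp only [Set.mem_ofPred_eq, Set.mem_singleton_iff]; grind]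
    exact Set.ncard_singleton _
  · rw [show {u | D.Adj u (corner n i)} = {nbr n i (i + 2)} by
      ext u; simp only [Set.mem_ofPred_eq, Set.mem_singleton_iff]; grind]
    exact Set.ncard_singleton _
  · rw [show {u | D.Adj u (corner n i)} = ∅ by
      ext u; simp only [Set.mem_ofPred_eq, Set.mem_empty_iff_false]; grind]
    exact Set.ncard_empty _

theorem inCount_state_reverse {n : ℕ} {D : Digraph (ℕ × ℕ)} (hD : IsOrientation (gasket n) D)
    (i : Fin 3) : inCount (state n (reverse D) i) = (inCount (state n D i)).rev := by
  classical
  have h : state n (reverse D) i = (!(state n D i).1, !(state n D i).2) := by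
    refine Prod.ext ((decide_eq_decide.2 ?_).trans decide_not)
      ((decide_eq_decide.2 ?_).trans decide_not)
    · exact (hD.not_adj_iff (corner_adj_nbr_next n i).symm).symm
    · exact (hD.not_adj_iff (corner_adj_nbr_prev n i).symm).symm
  rw [h]
  generalize state n D i = x
  revert x
  decide

theorem finite_setOf_adj {n : ℕ} {D : Digraph (ℕ × ℕ)} (hD : IsOrientation (gasket n) D)
    (v : ℕ × ℕ) : {u | D.Adj u v}.Finite :=
  (finite_vertices n).subset fun _ h => ⟨v, hD.adj h⟩

theorem ncard_glue_adj_middle {n : ℕ} {E : Fin 3 → Digraph (ℕ × ℕ)}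
    (hE : ∀ i, IsOrientation (gasket n) (E i)) {i j : Fin 3} (hij : i ≠ j) :
    {u | (glue n E).Adj u (corner n i + corner n j)}.ncard =
      inCount (state n (E i) j) + inCount (state n (E j) i) := by
  rw [setOf_glue_adj_middle hE hij, Set.ncard_union_eq ?_ ((finite_setOf_adj (hE i) _).image _)
    ((finite_setOf_adj (hE j) _).image _), Set.ncard_image_of_injective _ (add_left_injective _),
    Set.ncard_image_of_injective _ (add_left_injective _), ncard_adj_corner (hE i),
    ncard_adj_corner (hE j)]
  rw [Set.disjoint_left]
  rintro _ ⟨u, hu, rfl⟩ ⟨v, hv, h⟩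
  exact hij (copy_eq_of_adj ((hE i).adj hu) ((hE j).adj hv) h.symm (add_comm _ _))

/-- Each copy contributes two of the four edges here, so the ice rule says that the two inward
counts add up to 2; on `Fin 3`, `Fin.rev` is x ↦ 2 - x. -/
theorem iceRule_glue_middle {n : ℕ} {E : Fin 3 → Digraph (ℕ × ℕ)}
    (hE : ∀ i, IsOrientation (gasket n) (E i)) {i j : Fin 3} (hij : i ≠ j) :
    IceRule (glue n E) (corner n i + corner n j) ↔
      inCount (state n (E j) i) = (inCount (state n (E i) j)).rev := by
  have h := ncard_glue_adj_middle (fun i => (hE i).reverse) hij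
  rw [← reverse_glue, inCount_state_reverse (hE i), inCount_state_reverse (hE j)] at h
  simp only [reverse] at h
  rw [IceRule, h, ncard_glue_adj_middle hE hij]
  generalize inCount (state n (E i) j) = x
  generalize inCount (state n (E j) i) = y
  revert x y
  decide

theorem glue_mem_iceConfigs {n : ℕ} {E : Fin 3 → Digraph (ℕ × ℕ)}
    (hE : ∀ i, IsOrientation (gasket n) (E i)) :
    glue n E ∈ iceConfigs (n + 1) ↔ (∀ i, E i ∈ iceConfigs n) ∧
      ∀ i j, i ≠ j → inCount (state n (E j) i) = (inCount (state n (E i) j)).rev := by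
  constructor
  · rintro ⟨-, h⟩
    refine ⟨fun i => ⟨hE i, fun v hv hv' => ?_⟩, fun i j hij => ?_⟩
    · refine (iceRule_glue_interior hE hv hv').1
        (h _ ((mem_vertices_succ n _).2 ⟨i, v, hv, rfl⟩) ?_)
      rw [← range_corner] at hv' ⊢
      rintro ⟨k, hk⟩
      rw [corner_succ] at hk
      by_cases hki : k = i
      · subst hki
        exact hv' ⟨k, add_right_cancel hk⟩
      · exact hv' ⟨k, (eq_corner_of_add_corner_eq (corner_mem_vertices n k) hv hki hk).2.symm⟩
    · refine (iceRule_glue_middle hE hij).1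
        (h _ ((mem_vertices_succ n _).2 ⟨j, _, corner_mem_vertices n i, rfl⟩) ?_)
      rw [← range_corner]
      rintro ⟨k, hk⟩
      rw [corner_succ] at hk
      by_cases hkj : k = j
      · subst hkj
        exact hij (corner_injective n (add_right_cancel hk)).symm
      · have := eq_corner_of_add_corner_eq (corner_mem_vertices n k) (corner_mem_vertices n i)
          hkj hk
        exact hkj (corner_injective n this.1)
  · rintro ⟨h, h'⟩
    refine ⟨isOrientation_glue hE, fun v hv hv' => ?_⟩
    obtain ⟨i, v, hw, rfl⟩ := (mem_vertices_succ n _).1 hv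
    by_cases hvo : v ∈ outmost n
    · rw [← range_corner] at hvo hv'
      obtain ⟨j, rfl⟩ := hvo
      have hij : j ≠ i := by
        rintro rfl
        exact hv' ⟨j, corner_succ n j⟩
      exact (iceRule_glue_middle hE hij).2 (h' j i hij)
    · exact (iceRule_glue_interior hE hw hvo).2 ((h i).2 v hw hvo)

/-! ### Recursion for the counts with given corner states -/

theorem finite_iceConfigs (n : ℕ) : (iceConfigs n).Finite := by
  let f : Digraph (ℕ × ℕ) → Set ((ℕ × ℕ) × (ℕ × ℕ)) := fun D => {p | D.Adj p.1 p.2}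
  have hf : Function.Injective f := fun D D' h => by
    ext u v
    exact Set.ext_iff.1 h (u, v)
  refine Set.Finite.of_finite_image
    ((((finite_vertices n).prod (finite_vertices n)).finite_subsets).subset ?_) hf.injOn
  rintro _ ⟨D, hD, rfl⟩ p hp
  exact ⟨⟨_, hD.1.adj hp⟩, ⟨_, (hD.1.adj hp).symm⟩⟩

/-- The ice model configurations on `SG(n)` as a finite set. -/
noncomputable def configs (n : ℕ) : Finset (Digraph (ℕ × ℕ)) := (finite_iceConfigs n).toFinset

theorem mem_configs {n : ℕ} {D : Digraph (ℕ × ℕ)} : D ∈ configs n ↔ D ∈ iceConfigs n :=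
  Set.Finite.mem_toFinset _

open Classical in
/-- The number of ice model configurations with given states at the outmost vertices. -/
noncomputable def stateCount (n : ℕ) (σ : Fin 3 → Bool × Bool) : ℕ :=
  {D ∈ configs n | state n D = σ}.card

open Classical in
/-- The ice model configurations with given state at one outmost vertex and given numbers of
inward arrows at the two others. -/
noncomputable def partialConfigs (n : ℕ) (i : Fin 3) (p : Bool × Bool) (x y : Fin 3) :
    Finset (Digraph (ℕ × ℕ)) :=
  {D ∈ configs n | state n D i = p ∧ inCount (state n D (i + 1)) = x ∧
    inCount (state n D (i + 2)) = y}

/-- Here `e k` is the inward count that copy k+1 has at the vertex shared with copy k+2; the ice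
rule forces the reversed value on copy k+2. Once `e` is fixed the three copies are independent,
whence the product. -/
theorem stateCount_succ (n : ℕ) (σ : Fin 3 → Bool × Bool) :
    stateCount (n + 1) σ = ∑ e : Fin 3 → Fin 3,
      ∏ i, (partialConfigs n i (σ i) (e (i + 2)) (e (i + 1)).rev).card := by
  classical
  let T : Finset (Fin 3 → Digraph (ℕ × ℕ)) :=
    {E ∈ Fintype.piFinset fun _ => configs n |
      (∀ i j, i ≠ j → inCount (state n (E j) i) = (inCount (state n (E i) j)).rev) ∧
        ∀ i, state n (E i) i = σ i}
  have hT : ∀ E ∈ T, ∀ i, IsOrientation (gasket n) (E i) := fun E h i => by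
    simp only [T, Finset.mem_filter, Fintype.mem_piFinset, mem_configs] at h
    exact (h.1 i).1
  have h1 : stateCount (n + 1) σ = T.card := by
    refine Finset.card_nbij' (piece n) (glue n) ?_ ?_ ?_ ?_
    · intro D hD
      simp only [Finset.coe_filter, Set.mem_ofPred_eq, mem_configs] at hD
      have hE := isOrientation_piece hD.1.1
      have h := hD.1
      rw [← glue_piece hD.1.1, glue_mem_iceConfigs hE] at h
      simp only [T, Finset.coe_filter, Set.mem_ofPred_eq, mem_configs, Fintype.mem_piFinset]
      refine ⟨h.1, h.2, fun i => ?_⟩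
      rw [← state_glue hE, glue_piece hD.1.1, hD.2]
    · intro E hE
      have hE' := hT E hE
      simp only [T, Finset.coe_filter, Set.mem_ofPred_eq, mem_configs, Fintype.mem_piFinset] at hE ⊢
      refine ⟨(glue_mem_iceConfigs hE').2 ⟨hE.1, hE.2.1⟩, funext fun i => ?_⟩
      rw [state_glue hE', hE.2.2]
    · intro D hD
      simp only [Finset.coe_filter, Set.mem_ofPred_eq, mem_configs] at hD
      exact glue_piece hD.1.1
    · exact fun E hE => piece_glue (hT E hE)
  rw [h1, Finset.card_eq_sum_card_fiberwise
    (f := fun E (k : Fin 3) => inCount (state n (E (k + 1)) (k + 2))) (t := Finset.univ)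
    (fun _ _ => Finset.mem_coe.2 (Finset.mem_univ _))]
  refine Finset.sum_congr rfl fun e _ => ?_
  rw [← Fintype.card_piFinset]
  congr 1
  ext E
  simp only [T, partialConfigs, Finset.mem_filter, Fintype.mem_piFinset, funext_iff]
  have a1 : ∀ i : Fin 3, i + 2 + 1 = i := by decide
  have a2 : ∀ i : Fin 3, i + 2 + 2 = i + 1 := by decide
  have a3 : ∀ i : Fin 3, i + 1 + 1 = i + 2 := by decide
  have a4 : ∀ i : Fin 3, i + 1 + 2 = i := by decide
  have a5 : ∀ i : Fin 3, i + 1 ≠ i + 2 := by decide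
  have a6 : ∀ i j : Fin 3, i ≠ j → j = i + 1 ∨ i = j + 1 := by decide
  constructor
  · rintro ⟨⟨hE, hc, hs⟩, he⟩ i
    refine ⟨hE i, hs i, ?_, ?_⟩
    · rw [← he, a1, a2]
    · rw [← he, a3, a4, hc (i + 2) i (fun h => by revert i; decide)]
  · intro h
    refine ⟨⟨fun i => (h i).1, ?_, fun i => (h i).2.1⟩, fun k => ?_⟩
    · have key : ∀ i : Fin 3, inCount (state n (E (i + 1)) i) =
          (inCount (state n (E i) (i + 1))).rev := fun i => by
        have h1 := (h (i + 1)).2.2.2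
        rw [a4, a3] at h1
        rw [h1, (h i).2.2.1]
      intro i j hij
      obtain rfl | rfl := a6 i j hij
      · exact key i
      · rw [key j, Fin.rev_rev]
    · have := (h (k + 1)).2.2.1
      rwa [a3, a4] at this

/-! ### The four-parameter table and its closure under the recursion -/

/-- The number of configurations with one neutral corner, in state `p`, followed cyclically by
corners in the states `q` and `r`: it is `a` if the inward arrow of the neutral corner is on the side
of the corner with two inward arrows, and `b` if it is on the other side. -/
def chargedTable (a b : ℕ) (p q r : Bool × Bool) : ℕ :=
  if inCount q = 2 ∧ inCount r = 0 then (if p.1 then a else b)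
  else if inCount q = 0 ∧ inCount r = 2 then (if p.1 then b else a) else 0

/-- The number of configurations with given corner states `p`, `q`, `r`, in terms of its four
possible nonzero values `a`, `b`, `c`, `d`. -/
def table (a b c d : ℕ) (p q r : Bool × Bool) : ℕ :=
  if inCount p = 1 ∧ inCount q = 1 ∧ inCount r = 1 then (if p = q ∧ q = r then d else c)
  else if inCount p = 1 then chargedTable a b p q r
  else if inCount q = 1 then chargedTable a b q r p
  else if inCount r = 1 then chargedTable a b r p q
  else 0

/-- The sum of `table` over the states of the last two corners with given numbers of inward
arrows. -/
def partialTable (a b c d : ℕ) (p : Bool × Bool) (x y : Fin 3) : ℕ :=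
  if inCount p = 1 then
    if x = 1 ∧ y = 1 then d + 3 * c
    else if x = 2 ∧ y = 0 then (if p.1 then a else b)
    else if x = 0 ∧ y = 2 then (if p.1 then b else a) else 0
  else if (x = 1 ∧ y = (inCount p).rev) ∨ (x = (inCount p).rev ∧ y = 1) then a + b
  else 0

theorem table_rotate (a b c d : ℕ) (p q r : Bool × Bool) :
    table a b c d p q r = table a b c d q r p := by
  rcases p with ⟨_ | _, _ | _⟩ <;> rcases q with ⟨_ | _, _ | _⟩ <;>
    rcases r with ⟨_ | _, _ | _⟩ <;> rfl

/-- A neutral corner has two states and a charged one has a single state; this produces d + 3c and a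
+ b. -/
theorem sum_table (a b c d : ℕ) (p : Bool × Bool) (x y : Fin 3) :
    (∑ q, ∑ r, if inCount q = x ∧ inCount r = y then table a b c d p q r else 0) =
      partialTable a b c d p x y := by
  rcases p with ⟨_ | _, _ | _⟩ <;> fin_cases x <;> fin_cases y <;>
    simp [Fintype.sum_prod_type, inCount, table, chargedTable, partialTable] <;> ring

/-- Functions on `Fin 3` as triples. -/
def finThreeEquiv (α : Type*) : (Fin 3 → α) ≃ α × α × α where
  toFun f := (f 0, f 1, f 2)
  invFun x := ![x.1, x.2.1, x.2.2]
  left_inv f := by ext i; fin_cases i <;> rfl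
  right_inv _ := rfl

theorem sum_fin_three {α : Type*} [Fintype α] [DecidableEq α] (F : α → α → α → ℕ) :
    ∑ f : Fin 3 → α, F (f 0) (f 1) (f 2) = ∑ x, ∑ y, ∑ z, F x y z := by
  refine ((finThreeEquiv α).sum_comp fun x => F x.1 x.2.1 x.2.2).trans ?_
  simp only [Fintype.sum_prod_type]

-- With neutral outmost corners, either all shared vertices are neutral, giving (d + 3c)³, or charge
-- circulates through the copies in one of two senses, giving a³ + b³ or a²b + ab². With charged
-- outmost corners, their two copies contribute a + b each, and the third copy has both shared
-- vertices neutral (d + 3c) or both charged (a or b).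
set_option maxHeartbeats 4000000 in
theorem sum_partialTable (a b c d : ℕ) (p q r : Bool × Bool) :
    ∑ x : Fin 3, ∑ y : Fin 3, ∑ z : Fin 3, partialTable a b c d p z y.rev *
      partialTable a b c d q x z.rev * partialTable a b c d r y x.rev =
    table ((a + b) ^ 2 * (d + 3 * c + a)) ((a + b) ^ 2 * (d + 3 * c + b))
      ((d + 3 * c) ^ 3 + a * b * (a + b)) ((d + 3 * c) ^ 3 + a ^ 3 + b ^ 3) p q r := by
  rcases p with ⟨_ | _, _ | _⟩ <;> rcases q with ⟨_ | _, _ | _⟩ <;>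
    rcases r with ⟨_ | _, _ | _⟩ <;>
    simp [Fin.sum_univ_three, partialTable, inCount, table, chargedTable, Fin.rev] <;> ring

/-! ### The triangle `SG(0)` -/

/-- Whether the arrow between `corner 0 j` and `corner 0 i` points from `j` to `i`, for an
orientation of the triangle `SG(0)` with corner states `σ`. -/
def arrow (σ : Fin 3 → Bool × Bool) (j i : Fin 3) : Bool :=
  (j = i + 1 && (σ i).1) || (j = i + 2 && (σ i).2)

/-- The orientation of the triangle `SG(0)` with given corner states. -/
def triangle (σ : Fin 3 → Bool × Bool) : Digraph (ℕ × ℕ) :=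
  ⟨fun u v => ∃ j i, corner 0 j = u ∧ corner 0 i = v ∧ arrow σ j i⟩

theorem triangle_adj_corner (σ : Fin 3 → Bool × Bool) (j i : Fin 3) :
    (triangle σ).Adj (corner 0 j) (corner 0 i) ↔ arrow σ j i := by
  constructor
  · rintro ⟨j', i', hj, hi, h⟩
    rwa [corner_injective 0 hj, corner_injective 0 hi] at h
  · exact fun h => ⟨j, i, rfl, rfl, h⟩

theorem arrow_next (σ : Fin 3 → Bool × Bool) (i : Fin 3) : arrow σ (i + 1) i = (σ i).1 := by
  have : i + 1 ≠ i + 2 := by revert i; decide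
  simp [arrow, this]

theorem arrow_prev (σ : Fin 3 → Bool × Bool) (i : Fin 3) : arrow σ (i + 2) i = (σ i).2 := by
  have : i + 2 ≠ i + 1 := by revert i; decide
  simp [arrow, this]

theorem state_triangle (σ : Fin 3 → Bool × Bool) : state 0 (triangle σ) = σ := by
  ext i
  · simp only [state, nbr, triangle_adj_corner, arrow_next, Bool.decide_eq_true]
  · simp only [state, nbr, triangle_adj_corner, arrow_prev, Bool.decide_eq_true]

theorem adj_corner_iff_arrow (D : Digraph (ℕ × ℕ)) {j i : Fin 3} (hij : j ≠ i) :
    D.Adj (corner 0 j) (corner 0 i) ↔ arrow (state 0 D) j i := by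
  have : ∀ i j : Fin 3, j ≠ i → j = i + 1 ∨ j = i + 2 := by decide
  obtain rfl | rfl := this i j hij
  · rw [arrow_next]
    exact (@decide_eq_true_iff _ (_)).symm
  · rw [arrow_prev]
    exact (@decide_eq_true_iff _ (_)).symm

theorem isOrientation_triangle {σ : Fin 3 → Bool × Bool}
    (h : ∀ i, (σ i).1 = !(σ (i + 1)).2) : IsOrientation (gasket 0) (triangle σ) := by
  have key : ∀ i j, (i ≠ j ↔ (arrow σ i j = true ∨ arrow σ j i = true)) ∧
      ¬ (arrow σ i j = true ∧ arrow σ j i = true) := by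
    have h0 := h 0
    have h1 := h 1
    have h2 := h 2
    intro i j
    fin_cases i <;> fin_cases j <;> simp_all [arrow]
  intro u v
  by_cases hu : ∃ i, corner 0 i = u
  · by_cases hv : ∃ j, corner 0 j = v
    · obtain ⟨i, rfl⟩ := hu
      obtain ⟨j, rfl⟩ := hv
      rw [triangle_adj_corner, triangle_adj_corner, ← (key i j).1, gasket_zero_adj]
      refine ⟨⟨?_, fun hij => ⟨i, j, hij, rfl, rfl⟩⟩, (key i j).2⟩
      rintro ⟨i', j', hij, hi, hj⟩
      rwa [corner_injective 0 hi, corner_injective 0 hj]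
    · rw [gasket_zero_adj]
      simp only [triangle]
      grind
  · rw [gasket_zero_adj]
    simp only [triangle]
    grind

theorem mem_iceConfigs_zero {D : Digraph (ℕ × ℕ)} :
    D ∈ iceConfigs 0 ↔ IsOrientation (gasket 0) D := by
  refine ⟨fun h => h.1, fun h => ⟨h, fun v hv hv' => ?_⟩⟩
  obtain ⟨w, hw⟩ := hv
  obtain ⟨i, j, -, rfl, -⟩ := (gasket_zero_adj _ _).1 hw
  rw [← range_corner] at hv'
  exact absurd ⟨i, rfl⟩ hv'

theorem state_zero_consistent {D : Digraph (ℕ × ℕ)} (hD : IsOrientation (gasket 0) D)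
    (i : Fin 3) : (state 0 D i).1 = !(state 0 D (i + 1)).2 := by
  have h1 : i + 1 ≠ i := by revert i; decide
  have h2 := hD.not_adj_iff ((gasket_zero_adj (corner 0 (i + 1)) (corner 0 i)).2
    ⟨_, _, h1, rfl, rfl⟩)
  have h3 : ∀ i : Fin 3, i + 1 + 2 = i := by decide
  rw [adj_corner_iff_arrow D h1, adj_corner_iff_arrow D h1.symm, arrow_next] at h2
  have h4 := arrow_prev (state 0 D) (i + 1)
  rw [h3 i] at h4
  rw [h4] at h2
  revert h2
  generalize (state 0 D i).1 = x
  generalize (state 0 D (i + 1)).2 = y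
  revert x y
  decide

theorem configs_zero_filter (σ : Fin 3 → Bool × Bool) (D : Digraph (ℕ × ℕ)) :
    (D ∈ configs 0 ∧ state 0 D = σ) ↔ (∀ i, (σ i).1 = !(σ (i + 1)).2) ∧ D = triangle σ := by
  rw [mem_configs, mem_iceConfigs_zero]
  constructor
  · rintro ⟨hD, rfl⟩
    have hs := state_zero_consistent hD
    refine ⟨hs, ?_⟩
    have hT := isOrientation_triangle hs
    ext u v
    constructor
    · intro h
      obtain ⟨i, j, hij, rfl, rfl⟩ := (gasket_zero_adj u v).1 (hD.adj h)
      rwa [triangle_adj_corner, ← adj_corner_iff_arrow D hij]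
    · intro h
      obtain ⟨i, j, hij, rfl, rfl⟩ := (gasket_zero_adj u v).1 (hT.adj h)
      rwa [triangle_adj_corner, ← adj_corner_iff_arrow D hij] at h
  · rintro ⟨h, rfl⟩
    exact ⟨isOrientation_triangle h, state_triangle σ⟩

/-- All eight orientations of the triangle are allowed. The two cyclic ones give d = 1; the other
six have a source, a sink and a neutral corner whose inward arrow comes from the source, giving b =
1 and a = c = 0. -/
theorem stateCount_zero (σ : Fin 3 → Bool × Bool) :
    stateCount 0 σ = table 0 1 0 1 (σ 0) (σ 1) (σ 2) := by
  classical
  have h : stateCount 0 σ = if ∀ i, (σ i).1 = !(σ (i + 1)).2 then 1 else 0 := by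
    rw [stateCount]
    split_ifs with h
    · rw [Finset.card_eq_one]
      refine ⟨triangle σ, ?_⟩
      ext D
      rw [Finset.mem_filter, configs_zero_filter, Finset.mem_singleton]
      exact and_iff_right h
    · rw [Finset.card_eq_zero, Finset.filter_eq_empty_iff]
      exact fun D hD hs => h ((configs_zero_filter σ D).1 ⟨hD, hs⟩).1
  rw [h]
  have : (∀ i, (σ i).1 = !(σ (i + 1)).2) ↔
      (σ 0).1 = !(σ 1).2 ∧ (σ 1).1 = !(σ 2).2 ∧ (σ 2).1 = !(σ 0).2 := by
    simp [Fin.forall_fin_succ]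
  rw [if_congr this rfl rfl]
  generalize σ 0 = p
  generalize σ 1 = q
  generalize σ 2 = r
  revert p q r
  decide

theorem card_partialConfigs {n a b c d : ℕ}
    (h : ∀ σ, stateCount n σ = table a b c d (σ 0) (σ 1) (σ 2)) (i : Fin 3) (p : Bool × Bool)
    (x y : Fin 3) : (partialConfigs n i p x y).card = partialTable a b c d p x y := by
  classical
  have h' : ∀ σ, stateCount n σ = table a b c d (σ i) (σ (i + 1)) (σ (i + 2)) := by
    intro σ
    rw [h]
    fin_cases i
    · rfl
    · exact table_rotate ..
    · exact (table_rotate ..).trans (table_rotate ..)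
  rw [← sum_table, ← Fintype.sum_prod_type'
    (f := fun q r => if inCount q = x ∧ inCount r = y then table a b c d p q r else 0),
    ← Finset.sum_filter,
    Finset.card_eq_sum_card_fiberwise (f := fun D => (state n D (i + 1), state n D (i + 2)))
      (t := {qr | inCount qr.1 = x ∧ inCount qr.2 = y})]
  · refine Finset.sum_congr rfl fun qr hqr => ?_
    have a1 : ∀ i : Fin 3, i + 1 ≠ i := by decide
    have a2 : ∀ i : Fin 3, i + 2 ≠ i := by decide
    have a3 : ∀ i : Fin 3, i + 2 ≠ i + 1 := by decide
    have hs := h' fun j => if j = i then p else if j = i + 1 then qr.1 else qr.2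
    simp only [if_true, if_neg (a1 i), if_neg (a2 i), if_neg (a3 i)] at hs
    rw [← hs, stateCount]
    congr 1
    ext D
    simp only [partialConfigs, Finset.mem_filter, Finset.mem_univ, true_and] at hqr ⊢
    constructor
    · rintro ⟨⟨hD, hp, -, -⟩, rfl⟩
      refine ⟨hD, funext fun j => ?_⟩
      have : j = i ∨ j = i + 1 ∨ j = i + 2 := by
        clear * -
        revert i j
        decide
      obtain rfl | rfl | rfl := this <;> simp [*]
    · rintro ⟨hD, hs⟩
      have h0 := congrFun hs i
      have h1 := congrFun hs (i + 1)
      have h2 := congrFun hs (i + 2)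
      simp only [if_true, if_neg (a1 i), if_neg (a2 i), if_neg (a3 i)] at h0 h1 h2
      exact ⟨⟨hD, h0, h1 ▸ hqr.1, h2 ▸ hqr.2⟩, Prod.ext h1 h2⟩
  · intro D hD
    simp only [partialConfigs, Finset.coe_filter, Set.mem_ofPred_eq, Finset.mem_univ,
      true_and] at hD ⊢
    exact hD.2.2

/-! ### Closed recursion and the numbers I, pc, pd -/

/-- The four nonzero values `(a, b, c, d)` of the number of ice model configurations on `SG(n)`
with given corner states; see `table`. -/
def counts : ℕ → ℕ × ℕ × ℕ × ℕ
  | 0 => (0, 1, 0, 1)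
  | n + 1 =>
    let a := (counts n).1
    let b := (counts n).2.1
    let c := (counts n).2.2.1
    let d := (counts n).2.2.2
    ((a + b) ^ 2 * (d + 3 * c + a), (a + b) ^ 2 * (d + 3 * c + b),
      (d + 3 * c) ^ 3 + a * b * (a + b), (d + 3 * c) ^ 3 + a ^ 3 + b ^ 3)

theorem stateCount_eq (n : ℕ) (σ : Fin 3 → Bool × Bool) :
    stateCount n σ = table (counts n).1 (counts n).2.1 (counts n).2.2.1 (counts n).2.2.2
      (σ 0) (σ 1) (σ 2) := by
  induction n generalizing σ with
  | zero => exact stateCount_zero σ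
  | succ n ih =>
    rw [stateCount_succ]
    simp only [card_partialConfigs ih, Fin.prod_univ_three]
    refine (sum_fin_three fun x y z => partialTable _ _ _ _ (σ 0) z y.rev *
      partialTable _ _ _ _ (σ 1) x z.rev * partialTable _ _ _ _ (σ 2) y x.rev).trans ?_
    exact sum_partialTable ..

/-- Six arrangements of the inward counts 0, 1, 2 give a + b each; of the eight all-neutral state
triples, two give d and six give c. -/
theorem iceCount_eq (n : ℕ) :
    iceCount n = 6 * ((counts n).1 + (counts n).2.1) +
      2 * ((counts n).2.2.2 + 3 * (counts n).2.2.1) := by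
  classical
  have h : iceCount n = ∑ σ, stateCount n σ := by
    rw [iceCount, Set.ncard_eq_toFinset_card _ (finite_iceConfigs n)]
    exact Finset.card_eq_sum_card_fiberwise (f := state n) (t := Finset.univ)
      (fun _ _ => Finset.mem_coe.2 (Finset.mem_univ _))
  rw [h]
  simp only [stateCount_eq]
  rw [sum_fin_three (table _ _ _ _)]
  simp [Fintype.sum_prod_type, inCount, table, chargedTable]
  ring

theorem ncard_setOf_state (n : ℕ) (σ : Fin 3 → Bool × Bool) :
    {D ∈ iceConfigs n | state n D = σ}.ncard = stateCount n σ := by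
  classical
  rw [stateCount, ← Set.ncard_coe_finset]
  congr 1
  ext D
  simp [mem_configs]

theorem state_eq_next_iff {n : ℕ} {D : Digraph (ℕ × ℕ)} (hD : IsOrientation (gasket n) D)
    (i : Fin 3) : state n D i = (true, false) ↔
      D.Adj (nbr n i (i + 1)) (corner n i) ∧ D.Adj (corner n i) (nbr n i (i + 2)) := by
  rw [← hD.not_adj_iff (corner_adj_nbr_prev n i).symm]
  simp [state]

theorem state_eq_prev_iff {n : ℕ} {D : Digraph (ℕ × ℕ)} (hD : IsOrientation (gasket n) D)
    (i : Fin 3) : state n D i = (false, true) ↔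
      D.Adj (nbr n i (i + 2)) (corner n i) ∧ D.Adj (corner n i) (nbr n i (i + 1)) := by
  rw [← hD.not_adj_iff (corner_adj_nbr_next n i).symm, and_comm]
  simp [state]

theorem pcCount_eq (n : ℕ) : pcCount n = (counts n).2.2.1 := by
  have h : pcCount n = stateCount n ![(true, false), (true, false), (false, true)] := by
    rw [← ncard_setOf_state, pcCount]
    congr 1
    ext D
    simp only [Set.mem_ofPred_eq]
    refine and_congr_right fun hD => ?_
    have h0 := state_eq_next_iff hD.1 0
    have h1 := state_eq_next_iff hD.1 1
    have h2 := state_eq_prev_iff hD.1 2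
    simp [nbr_left, nbr_right, nbr_top, corner] at h0 h1 h2
    simp [funext_iff, Fin.forall_fin_succ, h0, h1, h2]
  rw [h, stateCount_eq]
  rfl

theorem pdCount_eq (n : ℕ) : pdCount n = (counts n).2.2.2 := by
  have h : pdCount n = stateCount n ![(true, false), (true, false), (true, false)] := by
    rw [← ncard_setOf_state, pdCount]
    congr 1
    ext D
    simp only [Set.mem_ofPred_eq]
    refine and_congr_right fun hD => ?_
    have h0 := state_eq_next_iff hD.1 0
    have h1 := state_eq_next_iff hD.1 1
    have h2 := state_eq_next_iff hD.1 2
    simp [nbr_left, nbr_right, nbr_top, corner] at h0 h1 h2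
    simp [funext_iff, Fin.forall_fin_succ, h0, h1, h2]
  rw [h, stateCount_eq]
  rfl

theorem counts_five : counts 5 =
    (75698740201563183383280644363997378678601043629777637830622335247543984853,
      75698743162171534700813654805040838340780124296431589571488195340807396614,
      530018911877721466313290053675074819078859848341907529578532307239712680741982409,
      530018911877721466619766910555496444373354873604416806906027332029660398356210238) := by
  norm_num [counts]

/-- The truncated subtraction is a true one, by `pc_le_pd`. -/
theorem counts_eight :
    10 ^ 101 * ((counts 8).2.2.2 - (counts 8).2.2.1) < (counts 8).2.2.1 := by
  norm_num [counts]

/-! ### Inequalities between s = `chargedCount`, t = `neutralCount`, e = `chargedDiff` -/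

/-- The number of configurations with a prescribed charged corner and no other restriction on
the remaining states than their numbers of inward arrows. -/
def chargedCount (n : ℕ) : ℝ := (counts n).1 + (counts n).2.1

/-- The number of configurations with a prescribed state at one corner and one inward arrow at
each of the others. -/
def neutralCount (n : ℕ) : ℝ := (counts n).2.2.2 + 3 * (counts n).2.2.1

/-- The difference of the two kinds of charged counts. -/
def chargedDiff (n : ℕ) : ℝ := (counts n).2.1 - (counts n).1

theorem chargedCount_succ (n : ℕ) :
    chargedCount (n + 1) = chargedCount n ^ 2 * (2 * neutralCount n + chargedCount n) := by
  simp only [chargedCount, neutralCount, counts]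
  push_cast
  ring

theorem neutralCount_succ (n : ℕ) :
    neutralCount (n + 1) = 4 * neutralCount n ^ 3 + chargedCount n ^ 3 := by
  simp only [chargedCount, neutralCount, counts]
  push_cast
  ring

theorem chargedDiff_succ (n : ℕ) :
    chargedDiff (n + 1) = chargedCount n ^ 2 * chargedDiff n := by
  simp only [chargedCount, chargedDiff, counts]
  push_cast
  ring

theorem sub_succ (n : ℕ) : ((counts (n + 1)).2.2.2 : ℝ) - (counts (n + 1)).2.2.1 =
    chargedCount n * chargedDiff n ^ 2 := by
  simp only [chargedCount, chargedDiff, counts]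
  push_cast
  ring

theorem chargedCount_pos (n : ℕ) : 0 < chargedCount n ∧ 0 < neutralCount n := by
  induction n with
  | zero => norm_num [chargedCount, neutralCount, counts]
  | succ n ih =>
    obtain ⟨h1, h2⟩ := ih
    rw [chargedCount_succ, neutralCount_succ]
    constructor <;> positivity

theorem neutralCount_pos (n : ℕ) : 0 < neutralCount n := (chargedCount_pos n).2

theorem chargedCount_le (n : ℕ) : chargedCount n ≤ neutralCount n := by
  induction n with
  | zero => norm_num [chargedCount, neutralCount, counts]
  | succ n ih =>
    obtain ⟨h1, h2⟩ := chargedCount_pos n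
    have h3 := mul_le_mul_of_nonneg_left ih (sq_nonneg (chargedCount n))
    have h4 := mul_le_mul_of_nonneg_right (pow_le_pow_left₀ h1.le ih 2) h2.le
    rw [chargedCount_succ, neutralCount_succ]
    nlinarith [pow_pos h1 3, pow_pos h2 3]

/-- The shift by 2 is needed: at stage 1, s = 3 and t = 5. -/
theorem two_mul_chargedCount_le (n : ℕ) : 2 * chargedCount (n + 2) ≤ neutralCount (n + 2) := by
  induction n with
  | zero => norm_num [chargedCount, neutralCount, counts]
  | succ n ih =>
    obtain ⟨h1, h2⟩ := chargedCount_pos (n + 2)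
    have h3 := chargedCount_le (n + 2)
    rw [chargedCount_succ (n + 2), neutralCount_succ (n + 2)]
    have h4 : chargedCount (n + 2) ^ 2 ≤ (neutralCount (n + 2) / 2) ^ 2 :=
      pow_le_pow_left₀ h1.le (by linarith) 2
    have h5 := mul_le_mul h4
      (show 2 * neutralCount (n + 2) + chargedCount (n + 2) ≤ 3 * neutralCount (n + 2) by linarith)
      (by positivity) (by positivity)
    nlinarith [pow_pos h1 3, pow_pos h2 3]

theorem three_mul_chargedCount_pow_le (n : ℕ) :
    3 * chargedCount n ^ 5 ≤ 16 * neutralCount n ^ 3 * chargedDiff n ^ 2 := by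
  match n with
  | 0 => norm_num [chargedCount, neutralCount, chargedDiff, counts]
  | 1 => norm_num [chargedCount, neutralCount, chargedDiff, counts]
  | n + 2 =>
    induction n with
    | zero => norm_num [chargedCount, neutralCount, chargedDiff, counts]
    | succ n ih =>
      have h := two_mul_chargedCount_le n
      obtain ⟨h1, h2⟩ := chargedCount_pos (n + 2)
      rw [chargedCount_succ (n + 2), neutralCount_succ (n + 2), chargedDiff_succ (n + 2)]
      set s := chargedCount (n + 2)
      set t := neutralCount (n + 2)
      set e := chargedDiff (n + 2)
      -- For s ≤ t/2 the left side is at most (3125/64)t⁶. The weaker s ≤ t would only give 243t⁶,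
      -- which is why stages 0 and 1 are checked separately.
      have h3 : s * (2 * t + s) ^ 5 ≤ 64 * t ^ 6 := by
        have : s * (2 * t + s) ^ 5 ≤ t / 2 * (2 * t + t / 2) ^ 5 := by gcongr <;> linarith
        nlinarith [pow_pos h2 6]
      calc 3 * (s ^ 2 * (2 * t + s)) ^ 5 = 3 * s ^ 9 * (s * (2 * t + s) ^ 5) := by ring
        _ ≤ 3 * s ^ 9 * (64 * t ^ 6) := by gcongr
        _ = (3 * s ^ 5) * (64 * t ^ 6 * s ^ 4) := by ring
        _ ≤ (16 * t ^ 3 * e ^ 2) * (64 * t ^ 6 * s ^ 4) := by gcongr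
        _ = 16 * (4 * t ^ 3 + 0) ^ 3 * (s ^ 2 * e) ^ 2 := by ring
        _ ≤ 16 * (4 * t ^ 3 + s ^ 3) ^ 3 * (s ^ 2 * e) ^ 2 := by gcongr; positivity

theorem pc_le_pd (n : ℕ) : ((counts n).2.2.1 : ℝ) ≤ (counts n).2.2.2 := by
  cases n with
  | zero => norm_num [counts]
  | succ n =>
    have := sub_succ n
    have := mul_nonneg (chargedCount_pos n).1.le (sq_nonneg (chargedDiff n))
    linarith

theorem cube_add_cube_le (n : ℕ) : ((counts n).1 : ℝ) ^ 3 + ((counts n).2.1 : ℝ) ^ 3 ≤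
    9 * ((counts n).2.2.2 - (counts n).2.2.1) * neutralCount n ^ 2 := by
  cases n with
  | zero => norm_num [neutralCount, counts]
  | succ n =>
    have h0 : ((counts (n + 1)).1 : ℝ) ^ 3 + ((counts (n + 1)).2.1 : ℝ) ^ 3 ≤
        chargedCount (n + 1) ^ 3 := by
      rw [chargedCount]
      have h1 : (0 : ℝ) ≤ (counts (n + 1)).1 := Nat.cast_nonneg _
      have h2 : (0 : ℝ) ≤ (counts (n + 1)).2.1 := Nat.cast_nonneg _
      nlinarith [mul_nonneg (mul_nonneg h1 h2) (add_nonneg h1 h2)]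
    refine h0.trans ?_
    have h := three_mul_chargedCount_pow_le n
    have h3 := chargedCount_le n
    obtain ⟨h1, h2⟩ := chargedCount_pos n
    rw [sub_succ, chargedCount_succ, neutralCount_succ]
    set s := chargedCount n
    set t := neutralCount n
    set e := chargedDiff n
    -- From s ≤ t the cube is at most 27s⁶t³, split so that 3s⁵ can be exchanged for 16t³e²; what
    -- results is 9(d' - c')(4t³)², and 4t³ ≤ t'.
    calc (s ^ 2 * (2 * t + s)) ^ 3 ≤ (s ^ 2 * (2 * t + t)) ^ 3 := by gcongr
      _ = (3 * s ^ 5) * (9 * s * t ^ 3) := by ring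
      _ ≤ (16 * t ^ 3 * e ^ 2) * (9 * s * t ^ 3) := by gcongr
      _ = 9 * (s * e ^ 2) * (4 * t ^ 3 + 0) ^ 2 := by ring
      _ ≤ 9 * (s * e ^ 2) * (4 * t ^ 3 + s ^ 3) ^ 2 := by gcongr; positivity

theorem pd_pos (n : ℕ) : (0 : ℝ) < (counts n).2.2.2 := by
  have := neutralCount_pos n
  have := pc_le_pd n
  rw [neutralCount] at *
  linarith

theorem pc_succ_pos (n : ℕ) : (0 : ℝ) < (counts (n + 1)).2.2.1 := by
  have h := neutralCount_pos n
  simp only [counts]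
  rw [neutralCount] at h
  push_cast
  positivity

/-! ### Monotone bounds and the limit -/

theorem monotone_log_neutralCount : Monotone fun n => Real.log (2 * neutralCount n) / 3 ^ n := by
  refine monotone_nat_of_le_succ fun n => ?_
  obtain ⟨h1, h2⟩ := chargedCount_pos n
  rw [div_le_div_iff₀ (by positivity) (by positivity), pow_succ, mul_comm ((3 : ℝ) ^ n), ← mul_assoc]
  gcongr
  rw [mul_comm, neutralCount_succ, show (3 : ℝ) = (3 : ℕ) by norm_num, ← Real.log_pow]
  refine Real.log_le_log (by positivity) ?_
  nlinarith [pow_pos h1 3]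

theorem antitone_log_pd : Antitone fun n => Real.log (8 * (counts n).2.2.2) / 3 ^ n := by
  refine antitone_nat_of_succ_le fun n => ?_
  have h := cube_add_cube_le n
  have hcd := pc_le_pd n
  have ht := neutralCount_pos n
  have hd := pd_pos n
  have hd' := pd_pos (n + 1)
  rw [div_le_div_iff₀ (by positivity) (by positivity), pow_succ, mul_comm ((3 : ℝ) ^ n), ← mul_assoc]
  gcongr
  rw [mul_comm _ (3 : ℝ), show (3 : ℝ) = (3 : ℕ) by norm_num, ← Real.log_pow]
  refine Real.log_le_log (by positivity) ?_
  have hsucc : ((counts (n + 1)).2.2.2 : ℝ) =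
      neutralCount n ^ 3 + (counts n).1 ^ 3 + (counts n).2.1 ^ 3 := by
    simp [neutralCount, counts]
  rw [hsucc]
  have h4 : neutralCount n =
      4 * (counts n).2.2.2 - 3 * ((counts n).2.2.2 - (counts n).2.2.1) := by
    rw [neutralCount]; ring
  set t := neutralCount n
  set d : ℝ := ((counts n).2.2.2 : ℝ)
  set δ : ℝ := d - ((counts n).2.2.1 : ℝ)
  have hδ : 0 ≤ δ := sub_nonneg.2 hcd
  -- By t ≤ 4d, 16d² + 4dt + t² ≥ 3t², so (4d)³ - t³ ≥ 9δt², which absorbs a³ + b³.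
  have h5 : 0 ≤ δ * (16 * d ^ 2 + 4 * d * t - 2 * t ^ 2) := by
    refine mul_nonneg hδ ?_
    have : t ≤ 4 * d := by linarith
    nlinarith
  have h6 : (4 * d) ^ 3 - t ^ 3 = 3 * δ * (16 * d ^ 2 + 4 * d * t + t ^ 2) := by
    rw [h4]; ring
  nlinarith

theorem log_neutralCount_le_log_pd (n : ℕ) :
    Real.log (2 * neutralCount n) / 3 ^ n ≤ Real.log (8 * (counts n).2.2.2) / 3 ^ n := by
  have h := neutralCount_pos n
  have := pc_le_pd n
  have : 2 * neutralCount n ≤ 8 * (counts n).2.2.2 := by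
    rw [neutralCount]
    linarith
  gcongr

theorem exists_tendsto_log_neutralCount : ∃ l : ℝ,
    Filter.Tendsto (fun n => Real.log (2 * neutralCount n) / 3 ^ n) Filter.atTop (nhds l) ∧
    (∀ m, Real.log (2 * neutralCount m) / 3 ^ m ≤ l) ∧
    ∀ m, l ≤ Real.log (8 * (counts m).2.2.2) / 3 ^ m := by
  have hle : ∀ n m, Real.log (2 * neutralCount n) / 3 ^ n ≤
      Real.log (8 * (counts m).2.2.2) / 3 ^ m := fun n m =>
    (monotone_log_neutralCount (le_max_left n m)).trans
      ((log_neutralCount_le_log_pd _).trans (antitone_log_pd (le_max_right n m)))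
  have hbdd : BddAbove (Set.range fun n => Real.log (2 * neutralCount n) / 3 ^ n) :=
    ⟨_, by rintro _ ⟨n, rfl⟩; exact hle n 0⟩
  exact ⟨_, tendsto_atTop_ciSup monotone_log_neutralCount hbdd, fun m => le_ciSup hbdd m,
    fun m => ciSup_le fun n => hle n m⟩

/-- From 2t ≤ I ≤ 8t, log I differs from log(2t) by at most log 4, which disappears after division
by 3^n; the factor 2/3 is the limit of 3^n / v. -/
theorem tendsto_log_iceCount {l : ℝ}
    (h : Filter.Tendsto (fun n => Real.log (2 * neutralCount n) / 3 ^ n) Filter.atTop (nhds l)) :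
    Filter.Tendsto (fun n => Real.log (iceCount n) / ((vertices n).ncard : ℝ)) Filter.atTop
      (nhds (2 / 3 * l)) := by
  have hpow : Filter.Tendsto (fun n : ℕ => (1 / 3 : ℝ) ^ n) Filter.atTop (nhds 0) :=
    tendsto_pow_atTop_nhds_zero_of_lt_one (by norm_num) (by norm_num)
  have hI : ∀ n, (iceCount n : ℝ) = 6 * chargedCount n + 2 * neutralCount n := fun n => by
    rw [iceCount_eq, chargedCount, neutralCount]
    push_cast
    ring
  have h1 : Filter.Tendsto (fun n => Real.log (iceCount n) / 3 ^ n) Filter.atTop (nhds l) := by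
    have h2 : Filter.Tendsto
        (fun n => Real.log (2 * neutralCount n) / 3 ^ n + Real.log 4 * (1 / 3 : ℝ) ^ n)
        Filter.atTop (nhds l) := by
      simpa using h.add (hpow.const_mul (Real.log 4))
    refine tendsto_of_tendsto_of_tendsto_of_le_of_le h h2 (fun n => ?_) (fun n => ?_)
    · obtain ⟨hs, ht⟩ := chargedCount_pos n
      simp only [hI]
      gcongr
      linarith
    · obtain ⟨hs, ht⟩ := chargedCount_pos n
      have := chargedCount_le n
      simp only [hI]
      rw [one_div, inv_pow, ← div_eq_mul_inv, ← add_div, ← Real.log_mul (by positivity) (by norm_num)]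
      gcongr
      linarith
  have h3 : Filter.Tendsto (fun n : ℕ => 2 / (3 + 3 * (1 / 3 : ℝ) ^ n)) Filter.atTop
      (nhds (2 / 3)) := by
    have := (hpow.const_mul 3).const_add (3 : ℝ)
    rw [mul_zero, add_zero] at this
    exact tendsto_const_nhds.div this (by norm_num)
  refine (h3.mul h1).congr fun n => ?_
  have hv : ((vertices n).ncard : ℝ) = (3 ^ (n + 1) + 3) / 2 := by
    have : (2 * (vertices n).ncard : ℝ) = 3 ^ (n + 1) + 3 := by
      exact_mod_cast two_mul_ncard_vertices n
    linarith
  rw [hv, one_div, inv_pow, pow_succ]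
  field_simp

theorem upperBound_eq (m : ℕ) :
    upperBound m = 2 / 3 * (Real.log (8 * (counts m).2.2.2) / 3 ^ m) := by
  rw [upperBound, pdCount_eq, Real.log_mul (by norm_num) (pd_pos m).ne',
    show (8 : ℝ) = 2 ^ 3 by norm_num, Real.log_pow, pow_succ]
  field_simp
  push_cast
  ring

/-- Stage 0 is excluded because pc(0) = 0, where `Real.log 0 = 0` would break the splitting of the
logarithm. -/
theorem lowerBound_eq {m : ℕ} (hm : 1 ≤ m) :
    lowerBound m = 2 / 3 * (Real.log (8 * (counts m).2.2.1) / 3 ^ m) := by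
  obtain ⟨m, rfl⟩ := Nat.exists_eq_add_of_le' hm
  rw [lowerBound, pcCount_eq, Real.log_mul (by norm_num) (pc_succ_pos m).ne',
    show (8 : ℝ) = 2 ^ 3 by norm_num, Real.log_pow, pow_succ _ (m + 1)]
  field_simp
  push_cast
  ring

theorem lowerBound_le {m : ℕ} (hm : 1 ≤ m) :
    lowerBound m ≤ 2 / 3 * (Real.log (2 * neutralCount m) / 3 ^ m) := by
  rw [lowerBound_eq hm]
  obtain ⟨m, rfl⟩ := Nat.exists_eq_add_of_le' hm
  have h := pc_succ_pos m
  have := pc_le_pd (m + 1)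
  have : 8 * (counts (m + 1)).2.2.1 ≤ 2 * neutralCount (m + 1) := by
    rw [neutralCount]
    linarith
  gcongr

/-! ### Numerical estimates -/

theorem upperBound_sub_lowerBound : upperBound 8 - lowerBound 8 < 1 / 10 ^ 101 := by
  have hc : (0 : ℝ) < (counts 8).2.2.1 := pc_succ_pos 7
  have hd : (0 : ℝ) < (counts 8).2.2.2 := pd_pos 8
  have hle := pc_le_pd 8
  have h1 : (10 : ℝ) ^ 101 * ((counts 8).2.2.2 - (counts 8).2.2.1) < (counts 8).2.2.1 := by
    rw [← Nat.cast_sub (by exact_mod_cast hle)]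
    exact_mod_cast counts_eight
  -- This is log x ≤ x - 1 at x = d/c.
  have h2 : Real.log (counts 8).2.2.2 - Real.log (counts 8).2.2.1 ≤
      ((counts 8).2.2.2 - (counts 8).2.2.1) / (counts 8).2.2.1 := by
    rw [← Real.log_div hd.ne' hc.ne', sub_div, div_self hc.ne']
    exact Real.log_le_sub_one_of_pos (by positivity)
  have h3 : ((counts 8).2.2.2 - (counts 8).2.2.1 : ℝ) / (counts 8).2.2.1 < 1 / 10 ^ 101 := by
    rw [div_lt_div_iff₀ hc (by positivity)]
    linarith
  have h4 : upperBound 8 - lowerBound 8 =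
      2 / 3 ^ 9 * (Real.log (counts 8).2.2.2 - Real.log (counts 8).2.2.1) := by
    rw [upperBound, lowerBound, pdCount_eq, pcCount_eq]
    ring
  have h5 : 0 ≤ Real.log (counts 8).2.2.2 - Real.log (counts 8).2.2.1 :=
    sub_nonneg.2 (Real.log_le_log hc hle)
  rw [h4]
  linarith

/-- The series of log((1 + x)/(1 - x)) at x = 1/3, cut after 16 terms. -/
theorem log_two_bounds : 0.6931471805599 < Real.log 2 ∧ Real.log 2 < 0.6931471805600 := by
  have h1 := Real.sum_range_le_log_div (x := 1 / 3) (by norm_num) (by norm_num) 16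
  have h2 := Real.log_div_le_sum_range_add (x := 1 / 3) (by norm_num) (by norm_num) 16
  rw [show (1 + 1 / 3 : ℝ) / (1 - 1 / 3) = 2 by norm_num] at h1 h2
  norm_num [Finset.sum_range_succ] at h1 h2
  constructor <;> linarith

/-- Stage 5 suffices, as pc(5) and pd(5) agree in their first 18 digits. With r = pc(5)/2^268, the
rational x is (r - 1)/(r + 1) rounded down, so that r ≥ (1 + x)/(1 - x); for the upper bound x is
rounded up. -/
theorem le_lowerBound_five : 0.515648810655 ≤ lowerBound 5 := by
  have h := log_two_bounds.1
  have h1 := Real.sum_range_le_log_div (x := 0.05549569919) (by norm_num) (by norm_num) 6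
  have h2 : Real.log (2 ^ 268 * ((1 + 0.05549569919) / (1 - 0.05549569919))) ≤
      Real.log (counts 5).2.2.1 := by
    rw [counts_five]
    refine Real.log_le_log (by positivity) ?_
    -- Splitting the power keeps the exponents small enough for `norm_num` to evaluate.
    rw [show (2 : ℝ) ^ 268 = 2 ^ 134 * 2 ^ 134 by rw [← pow_add]]
    norm_num
  rw [Real.log_mul (by norm_num) (by norm_num), Real.log_pow] at h2
  rw [lowerBound, pcCount_eq]
  generalize Real.log ((1 + 0.05549569919) / (1 - 0.05549569919)) = y at h1 h2
  generalize Real.log (counts 5).2.2.1 = z at h2 ⊢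
  norm_num [Finset.sum_range_succ] at h1 h2 ⊢
  linarith

theorem upperBound_five_lt : upperBound 5 < 0.515648810656 := by
  have h := log_two_bounds.2
  have h1 := Real.log_div_le_sum_range_add (x := 0.05549569921) (by norm_num) (by norm_num) 6
  have h2 : Real.log (counts 5).2.2.2 ≤
      Real.log (2 ^ 268 * ((1 + 0.05549569921) / (1 - 0.05549569921))) := by
    rw [counts_five]
    refine Real.log_le_log (by positivity) ?_
    rw [show (2 : ℝ) ^ 268 = 2 ^ 134 * 2 ^ 134 by rw [← pow_add]]
    norm_num
  rw [Real.log_mul (by norm_num) (by norm_num), Real.log_pow] at h2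
  rw [upperBound, pdCount_eq]
  generalize Real.log ((1 + 0.05549569921) / (1 - 0.05549569921)) = y at h1 h2
  generalize Real.log (counts 5).2.2.2 = z at h2 ⊢
  norm_num [Finset.sum_range_succ] at h1 h2 ⊢
  linarith

end SierpinskiIce

theorem proposition1 :
    ∃ S : ℝ,
      Filter.Tendsto
        (fun n : ℕ => Real.log (SierpinskiIce.iceCount n : ℝ) /
          ((SierpinskiIce.vertices n).ncard : ℝ))
        Filter.atTop (nhds S) ∧
      (0.515648810655 ≤ S ∧ S < 0.515648810656) ∧
      (∀ m : ℕ, 1 ≤ m → SierpinskiIce.lowerBound m ≤ S ∧ S ≤ SierpinskiIce.upperBound m) ∧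
      SierpinskiIce.upperBound 8 - SierpinskiIce.lowerBound 8 < 1 / 10 ^ 101 := by
  obtain ⟨l, hl, hlow, hup⟩ := SierpinskiIce.exists_tendsto_log_neutralCount
  have hL : ∀ m : ℕ, 1 ≤ m → SierpinskiIce.lowerBound m ≤ 2 / 3 * l := fun m hm =>
    (SierpinskiIce.lowerBound_le hm).trans (by gcongr; exact hlow m)
  have hU : ∀ m : ℕ, 2 / 3 * l ≤ SierpinskiIce.upperBound m := fun m => by
    rw [SierpinskiIce.upperBound_eq]
    gcongr
    exact hup m
  exact ⟨2 / 3 * l, SierpinskiIce.tendsto_log_iceCount hl,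
    ⟨SierpinskiIce.le_lowerBound_five.trans (hL 5 (by norm_num)),
      (hU 5).trans_lt SierpinskiIce.upperBound_five_lt⟩,
    fun m hm => ⟨hL m hm, hU m⟩, SierpinskiIce.upperBound_sub_lowerBound⟩
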